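/- For $n\in\mathbb N$ let $\mathcal A_n$ be the C*-algebra $(\mathbb C^n,\|\cdot\|_\infty)$ with coordinatewise operations, and let $M_n(\mathbb C)_+$ be the set of positive semidefinite matrices in $M_n(\mathbb C)$. Put $$\mathcal Q_n=\{X\in M_n(\mathbb C): X\ge 0,\ \operatorname{diag}(X)=I_n\},$$ and let $\mathcal R_n\subseteq M_n(\mathbb C)$ be the closed convex hull of the rank one matrices $(\overline{u_i}\,u_j)_{i,j}$, where $u\in\mathbb C^n$ is a unitary of $\mathcal A_n$, i.e. $|u_j|=1$ for all $j$. For a complex $m\times n$ matrix $X$ let $F_X:\mathcal A_n\to\mathbb C^m$, $a\mapsto Xa$, where $\mathbb C^m=M_{m,1}(\mathbb C)$ is the column Hilbert space. Let $\|X\|_F$ be the norm of $F_X$ as an operator from $(\mathbb C^n,\|\cdot\|_\infty)$ to $(\mathbb C^m,\|\cdot\|_2)$, and let $\|X\|_{cbF}$ be its completely bounded norm, i.e. the supremum over $k\in\mathbb N$ of the norms of the maps $M_k(\mathcal A_n)\to M_k(M_{m,1}(\mathbb C))$, $[a_{st}]\mapsto[F_X(a_{st})]$. Let $k_G^{\mathbb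 C}$ be the complex little Grothendieck constant, i.e. the smallest positive real $\kappa$ such that $\|X\|_{cbF}\le\sqrt{\kappa}\,\|X\|_F$ for all $m,n$ and all complex $m\times n$ matrices $X$. **Proposition.** For every $n\in\mathbb N$ and every $Q\in\mathcal Q_n$ there exist $R\in\mathcal R_n$ and $P\in M_n(\mathbb C)_+$ such that $$Q=k_G^{\mathbb C}\,R-P.$$ -/

import Mathlib

open scoped ComplexOrder

namespace LittleGrothendieck

/-- The operator `F_X : (ℂⁿ, ‖·‖_∞) → (ℂᵐ, ‖·‖₂)`, `a ↦ X a`, given by a complex `m × n` matrix. -/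
noncomputable def opF {m n : ℕ} (X : Matrix (Fin m) (Fin n) ℂ) :
    (Fin n → ℂ) →L[ℂ] EuclideanSpace ℂ (Fin m) :=
  LinearMap.toContinuousLinearMap
    ((WithLp.linearEquiv 2 ℂ (Fin m → ℂ)).symm.toLinearMap ∘ₗ X.mulVecLin)

/-- `‖X‖_F`, the operator norm of `F_X`. -/
noncomputable def normF {m n : ℕ} (X : Matrix (Fin m) (Fin n) ℂ) : ℝ := ‖opF X‖

section Amplification

open scoped Matrix.Norms.L2Operator

/-- The `k`-th amplification `M_k(𝒜ₙ) → M_k(M_{m,1}(ℂ))`, `[a_{st}] ↦ [F_X(a_{st})]`, where `ℂᵐ`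
is the column Hilbert space `M_{m,1}(ℂ)`. An element of `M_k(𝒜ₙ)`, `𝒜ₙ = C({1,…,n}, ℂ)`, is a
family `A 1, …, A n` of `k × k` matrices (`a_{st}` is the function `j ↦ A j s t`), with C*-norm
`max_j ‖A j‖`; an element of `M_k(M_{m,1}(ℂ))` is an `mk × k` matrix with its operator norm. -/
noncomputable def ampF (k : ℕ) {m n : ℕ} (X : Matrix (Fin m) (Fin n) ℂ) :
    (Fin n → Matrix (Fin k) (Fin k) ℂ) →L[ℂ] Matrix (Fin m × Fin k) (Fin k) ℂ :=
  LinearMap.toContinuousLinearMap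
    { toFun := fun A => Matrix.of fun p t => opF X (fun j => A j p.2 t) p.1
      map_add' := fun A B => by
        ext p t
        exact congrArg (fun v : EuclideanSpace ℂ (Fin m) => v p.1)
          ((opF X).map_add (fun j => A j p.2 t) (fun j => B j p.2 t))
      map_smul' := fun c A => by
        ext p t
        exact congrArg (fun v : EuclideanSpace ℂ (Fin m) => v p.1)
          ((opF X).map_smul c (fun j => A j p.2 t)) }

/-- `‖X‖_{cbF}`, the completely bounded norm of `F_X`: the supremum over `k` of the norms of the
amplifications of `F_X` (finite, see `bddAbove_norm_ampF`). -/
noncomputable def normCbF {m n : ℕ} (X : Matrix (Fin m) (Fin n) ℂ) : ℝ := ⨆ k : ℕ, ‖ampF k X‖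

theorem bddAbove_norm_ampF {m n : ℕ} (X : Matrix (Fin m) (Fin n) ℂ) :
    BddAbove (Set.range fun k : ℕ => ‖ampF k X‖) := by
  refine ⟨∑ i, ∑ j, ‖X i j‖, ?_⟩
  rintro _ ⟨k, rfl⟩
  refine ContinuousLinearMap.opNorm_le_bound _ (by positivity) fun A => ?_
  let E : Fin m → Matrix (Fin m × Fin k) (Fin k) ℂ := fun i =>
    Matrix.of fun p t => if p.1 = i ∧ p.2 = t then 1 else 0
  have hone : ‖(1 : Matrix (Fin k) (Fin k) ℂ)‖ ≤ 1 := by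
    have h := Matrix.l2_opNorm_conjTranspose_mul_self (1 : Matrix (Fin k) (Fin k) ℂ)
    simp only [Matrix.conjTranspose_one, mul_one] at h
    nlinarith [norm_nonneg (1 : Matrix (Fin k) (Fin k) ℂ)]
  have hE : ∀ i, ‖E i‖ ≤ 1 := by
    intro i
    have h := Matrix.l2_opNorm_conjTranspose_mul_self (E i)
    have h1 : (E i).conjTranspose * E i = 1 := by
      ext s t
      simp only [Matrix.mul_apply, Matrix.conjTranspose_apply, E, Matrix.of_apply,
        Fintype.sum_prod_type, Matrix.one_apply]
      rw [Finset.sum_eq_single i (by intro b _ hb; simp [hb]) (by simp)]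
      rw [Finset.sum_eq_single s (by intro b _ hb; simp [hb]) (by simp)]
      simp
    rw [h1] at h
    nlinarith [norm_nonneg (E i)]
  have hA : ampF k X A = ∑ i, ∑ j, X i j • (E i * A j) := by
    ext p t
    simp only [Matrix.sum_apply, Matrix.smul_apply, Matrix.mul_apply, E, Matrix.of_apply]
    rw [Finset.sum_eq_single p.1 (by intro b _ hb; simp [Ne.symm hb]) (by simp)]
    change (X.mulVec fun j => A j p.2 t) p.1 = _
    simp [Matrix.mulVec, dotProduct]
  rw [hA, Finset.sum_mul]
  refine norm_sum_le_of_le _ fun i _ => ?_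
  rw [Finset.sum_mul]
  refine norm_sum_le_of_le _ fun j _ => ?_
  rw [norm_smul]
  refine mul_le_mul_of_nonneg_left ?_ (norm_nonneg _)
  calc ‖E i * A j‖ ≤ ‖E i‖ * ‖A j‖ := Matrix.l2_opNorm_mul _ _
    _ ≤ 1 * ‖A‖ := mul_le_mul (hE i) (norm_le_pi_norm A j) (norm_nonneg _) zero_le_one
    _ = ‖A‖ := one_mul _

end Amplification

/-- The complex little Grothendieck constant `k_G^ℂ`: the smallest positive real `κ` such that
`‖X‖_{cbF} ≤ √κ ‖X‖_F` for all complex matrices `X` of all sizes. -/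
noncomputable def kG : ℝ :=
  sInf {κ : ℝ | 0 < κ ∧
    ∀ (m n : ℕ) (X : Matrix (Fin m) (Fin n) ℂ), normCbF X ≤ Real.sqrt κ * normF X}

/-- `𝒬ₙ`: the positive `n × n` matrices with diagonal `Iₙ`. -/
def setQ (n : ℕ) : Set (Matrix (Fin n) (Fin n) ℂ) :=
  {X | X.PosSemidef ∧ ∀ i, X i i = 1}

/-- `ℛₙ`: the closed convex hull of the rank one matrices `(u*)_| u_-`, `u` unitary in `𝒜ₙ`. -/
def setR (n : ℕ) : Set (Matrix (Fin n) (Fin n) ℂ) :=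
  closure (convexHull ℝ {X | ∃ u ∈ unitary (Fin n → ℂ), X = Matrix.vecMulVec (star u) u})

end LittleGrothendieck

namespace LittleGrothendieck

/-! The proof is by convex duality. The set of all `kG • R - P` is closed and convex, so a `Q`
outside it is separated from it by a real functional `f`, with `f < s` on the set and `s < f Q`.
Subtracting large multiples of `P` forces `f ≥ 0` on positive semidefinite matrices, hence `f (Wᴴ W)
= tensorSq X W` for some matrix `X`. Rank one elements of `setR n` give `kG * ‖X‖_F² ≤ s`. Writing
`Q = Gᴴ G` with unit columns gives `f Q ≤ ‖X‖_cbF² ≤ kG * ‖X‖_F²`, a contradiction.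

The last inequality (`normCbF_sq_le`) needs some finite constant to be admissible in the infimum
defining `kG`. A truncated Rademacher average supplies 48 (`tensorSqBound_normF`). -/

/-- The squared Hilbert-space norm of `∑ j, x j ⊗ w j`, where `x j` are the columns of `X` and
`w j` are the vectors `W j`. -/
noncomputable def tensorSq {m n : ℕ} {ι : Type} [Fintype ι] (X : Matrix (Fin m) (Fin n) ℂ)
    (W : Fin n → ι → ℂ) : ℝ :=
  ∑ p, ∑ a, ‖∑ j, X p j * W j a‖ ^ 2

/-! ### Moments of Rademacher sums -/

theorem norm_add_sq_add_norm_sub_sq (a b : ℂ) :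
    ‖a + b‖ ^ 2 + ‖a - b‖ ^ 2 = 2 * (‖a‖ ^ 2 + ‖b‖ ^ 2) := by
  have := parallelogram_law_with_norm ℝ a b
  nlinarith [this]

/-- With `σ = ‖a‖² + ‖b‖²` and `τ = Re (a * conj b)`, the left side is `2σ² + 8τ²`, and `τ² ≤
‖a‖²‖b‖²`. -/
theorem norm_add_pow_four_add_norm_sub_pow_four_le (a b : ℂ) :
    ‖a + b‖ ^ 4 + ‖a - b‖ ^ 4 ≤ 2 * (‖a‖ ^ 4 + 6 * (‖a‖ ^ 2 * ‖b‖ ^ 2) + ‖b‖ ^ 4) := by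
  have h4 : ∀ z : ℂ, ‖z‖ ^ 4 = (z.re ^ 2 + z.im ^ 2) ^ 2 := by
    intro z
    rw [show ‖z‖ ^ 4 = (‖z‖ ^ 2) ^ 2 by ring, Complex.sq_norm, Complex.normSq_apply]; ring
  have h2 : ∀ z : ℂ, ‖z‖ ^ 2 = z.re ^ 2 + z.im ^ 2 := by
    intro z
    rw [Complex.sq_norm, Complex.normSq_apply]; ring
  rw [h4, h4, h4, h4, h2, h2]
  simp only [Complex.add_re, Complex.add_im, Complex.sub_re, Complex.sub_im]
  nlinarith [sq_nonneg (a.re * b.im - a.im * b.re)]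

/-- Rademacher sums: random signs for which the second moment of a linear combination is the
squared norm of the coefficients and the fourth moment is at most three times its square. -/
theorem exists_rademacher (k : ℕ) :
    ∃ (Ω : Type) (_ : Fintype Ω) (_ : Nonempty Ω) (ε : Fin k → Ω → ℂ), ∀ w : Fin k → ℂ,
      ∑ ω, ‖∑ a, w a * ε a ω‖ ^ 2 = Fintype.card Ω * ∑ a, ‖w a‖ ^ 2 ∧
      ∑ ω, ‖∑ a, w a * ε a ω‖ ^ 4 ≤ 3 * Fintype.card Ω * (∑ a, ‖w a‖ ^ 2) ^ 2 := by
  induction k with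
  | zero => exact ⟨Unit, inferInstance, inferInstance, fun _ _ => 0, by simp⟩
  | succ k ih =>
    obtain ⟨Ω, _, _, ε, h⟩ := ih
    refine ⟨Ω × Bool, inferInstance, inferInstance,
      Fin.cons (fun ω => if ω.2 then 1 else -1) fun a ω => ε a ω.1, fun w => ?_⟩
    obtain ⟨h2, h4⟩ := h fun a => w a.succ
    simp only [Fin.sum_univ_succ, Fin.cons_zero, Fin.cons_succ, Fintype.sum_prod_type,
      Fintype.sum_bool, Fintype.card_prod, Fintype.card_bool, if_true, mul_one, Nat.cast_mul,
      Nat.cast_ofNat, Bool.false_eq_true, if_false, mul_neg]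
    set f : Ω → ℂ := fun ω => ∑ a : Fin k, w a.succ * ε a ω with hf
    set s := ∑ a : Fin k, ‖w a.succ‖ ^ 2 with hs
    change ∑ ω, ‖f ω‖ ^ 2 = _ at h2
    change ∑ ω, ‖f ω‖ ^ 4 ≤ _ at h4
    have hcomm : ∀ ω, ‖-w 0 + f ω‖ = ‖f ω - w 0‖ := fun ω => by rw [neg_add_eq_sub]
    have hcomm' : ∀ ω, ‖w 0 + f ω‖ = ‖f ω + w 0‖ := fun ω => by rw [add_comm]
    have hcard : ∑ _ω : Ω, ‖w 0‖ ^ 2 = Fintype.card Ω * ‖w 0‖ ^ 2 := by simp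
    have hcard4 : ∑ _ω : Ω, ‖w 0‖ ^ 4 = Fintype.card Ω * ‖w 0‖ ^ 4 := by simp
    constructor
    · calc ∑ ω, (‖w 0 + f ω‖ ^ 2 + ‖-w 0 + f ω‖ ^ 2)
          = ∑ ω, 2 * (‖f ω‖ ^ 2 + ‖w 0‖ ^ 2) := by
            refine Finset.sum_congr rfl fun ω _ => ?_
            rw [hcomm, hcomm', norm_add_sq_add_norm_sub_sq]
        _ = _ := by
            rw [← Finset.mul_sum, Finset.sum_add_distrib, h2, hcard]; ring
    · calc ∑ ω, (‖w 0 + f ω‖ ^ 4 + ‖-w 0 + f ω‖ ^ 4)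
          ≤ ∑ ω, 2 * (‖f ω‖ ^ 4 + 6 * (‖f ω‖ ^ 2 * ‖w 0‖ ^ 2) + ‖w 0‖ ^ 4) := by
            refine Finset.sum_le_sum fun ω _ => ?_
            rw [hcomm, hcomm']
            exact norm_add_pow_four_add_norm_sub_pow_four_le _ _
        _ = 2 * (∑ ω, ‖f ω‖ ^ 4 + 6 * (Fintype.card Ω * s * ‖w 0‖ ^ 2)
              + Fintype.card Ω * ‖w 0‖ ^ 4) := by
            rw [← Finset.mul_sum, Finset.sum_add_distrib, Finset.sum_add_distrib,
              ← Finset.mul_sum, ← Finset.sum_mul, h2, hcard4]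
        -- Raising the last coefficient from 1 to 3 completes the square `3 (s + ‖w 0‖²)²`.
        _ ≤ 2 * (3 * Fintype.card Ω * s ^ 2 + 6 * (Fintype.card Ω * s * ‖w 0‖ ^ 2)
              + 3 * (Fintype.card Ω * ‖w 0‖ ^ 4)) := by
            have : 0 ≤ (Fintype.card Ω : ℝ) * ‖w 0‖ ^ 4 := by positivity
            linarith
        _ = _ := by ring

theorem exists_rademacher_fintype (ι : Type) [Fintype ι] :
    ∃ (Ω : Type) (_ : Fintype Ω) (_ : Nonempty Ω) (ε : ι → Ω → ℂ), ∀ w : ι → ℂ,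
      ∑ ω, ‖∑ a, w a * ε a ω‖ ^ 2 = Fintype.card Ω * ∑ a, ‖w a‖ ^ 2 ∧
      ∑ ω, ‖∑ a, w a * ε a ω‖ ^ 4 ≤ 3 * Fintype.card Ω * (∑ a, ‖w a‖ ^ 2) ^ 2 := by
  obtain ⟨Ω, i, j, ε, h⟩ := exists_rademacher (Fintype.card ι)
  let e := Fintype.equivFin ι
  refine ⟨Ω, i, j, fun a => ε (e a), fun w => ?_⟩
  have h1 : ∀ ω, ∑ a, w a * ε (e a) ω = ∑ a, w (e.symm a) * ε a ω := fun ω => by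
    rw [← e.sum_comp]; simp
  have h2 : ∑ a, ‖w a‖ ^ 2 = ∑ a, ‖w (e.symm a)‖ ^ 2 := by
    rw [← e.sum_comp]; simp
  simp only [h1, h2]
  exact h _

/-! ### A little Grothendieck inequality by truncation -/

theorem norm_opF_sq {m n : ℕ} (X : Matrix (Fin m) (Fin n) ℂ) (a : Fin n → ℂ) :
    ‖opF X a‖ ^ 2 = ∑ p, ‖∑ j, X p j * a j‖ ^ 2 := by
  rw [EuclideanSpace.norm_sq_eq]
  rfl

theorem tensorSq_eq_sum_norm_opF_sq {m n : ℕ} {ι : Type} [Fintype ι]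
    (X : Matrix (Fin m) (Fin n) ℂ) (W : Fin n → ι → ℂ) :
    tensorSq X W = ∑ a, ‖opF X fun j => W j a‖ ^ 2 := by
  simp only [norm_opF_sq]
  exact Finset.sum_comm

theorem tensorSq_const_mul {m n : ℕ} {ι : Type} [Fintype ι] (X : Matrix (Fin m) (Fin n) ℂ)
    (W : Fin n → ι → ℂ) (c : ℂ) :
    tensorSq X (fun j a => c * W j a) = ‖c‖ ^ 2 * tensorSq X W := by
  simp only [tensorSq, Finset.mul_sum, ← mul_pow, ← norm_mul]
  simp only [mul_left_comm]

theorem tensorSq_add_le {m n : ℕ} {ι : Type} [Fintype ι] (X : Matrix (Fin m) (Fin n) ℂ)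
    (V W : Fin n → ι → ℂ) :
    tensorSq X (fun j a => V j a + W j a) ≤ 2 * tensorSq X V + 2 * tensorSq X W := by
  simp only [tensorSq, Finset.mul_sum, ← Finset.sum_add_distrib]
  refine Finset.sum_le_sum fun p _ => Finset.sum_le_sum fun a _ => ?_
  have := norm_add_sq_add_norm_sub_sq (∑ j, X p j * V j a) (∑ j, X p j * W j a)
  simp only [mul_add, Finset.sum_add_distrib]
  nlinarith [sq_nonneg ‖∑ j, X p j * V j a - ∑ j, X p j * W j a‖]

/-- `c` bounds `tensorSq X` on all families of vectors of norm at most one. -/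
def TensorSqBound {m n : ℕ} (X : Matrix (Fin m) (Fin n) ℂ) (c : ℝ) : Prop :=
  ∀ (ι : Type) [Fintype ι] (W : Fin n → ι → ℂ), (∀ j, ∑ a, ‖W j a‖ ^ 2 ≤ 1) → tensorSq X W ≤ c

theorem TensorSqBound.nonneg {m n : ℕ} {X : Matrix (Fin m) (Fin n) ℂ} {c : ℝ}
    (h : TensorSqBound X c) : 0 ≤ c := by
  simpa [tensorSq] using h Unit (fun _ _ => 0) (by simp)

theorem TensorSqBound.le_mul {m n : ℕ} {X : Matrix (Fin m) (Fin n) ℂ} {c : ℝ}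
    (h : TensorSqBound X c) {ι : Type} [Fintype ι] (W : Fin n → ι → ℂ) {r : ℝ} (hr : 0 ≤ r)
    (hW : ∀ j, ∑ a, ‖W j a‖ ^ 2 ≤ r) : tensorSq X W ≤ c * r := by
  rcases hr.eq_or_lt with rfl | hr
  · have h0 : ∀ j a, W j a = 0 := fun j a => by
      have := Finset.single_le_sum (f := fun a => ‖W j a‖ ^ 2) (fun _ _ => by positivity)
        (Finset.mem_univ a)
      have h1 : ‖W j a‖ ^ 2 = 0 := le_antisymm (this.trans (hW j)) (by positivity)
      simpa using h1
    simp [tensorSq, h0]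
  · have hc : ‖((Real.sqrt r)⁻¹ : ℂ)‖ ^ 2 = r⁻¹ := by
      rw [norm_inv, Complex.norm_real, inv_pow, Real.norm_eq_abs, sq_abs, Real.sq_sqrt hr.le]
    have := h ι (fun j a => ((Real.sqrt r)⁻¹ : ℂ) * W j a) fun j => by
      simp only [norm_mul, mul_pow, hc]
      rw [← Finset.mul_sum, inv_mul_le_iff₀ hr, mul_one]
      exact hW j
    rw [tensorSq_const_mul, hc, inv_mul_le_iff₀ hr] at this
    linarith

theorem exists_tensorSqBound {m n : ℕ} (X : Matrix (Fin m) (Fin n) ℂ) :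
    ∃ c, TensorSqBound X c := by
  refine ⟨∑ p, (∑ j, ‖X p j‖ ^ 2) * n, fun ι _ W hW => Finset.sum_le_sum fun p _ => ?_⟩
  calc ∑ a, ‖∑ j, X p j * W j a‖ ^ 2
      ≤ ∑ a, (∑ j, ‖X p j‖ ^ 2) * ∑ j, ‖W j a‖ ^ 2 := by
        refine Finset.sum_le_sum fun a _ => ?_
        refine le_trans ?_ (Finset.sum_mul_sq_le_sq_mul_sq Finset.univ _ _)
        gcongr
        exact norm_sum_le_of_le _ fun j _ => (norm_mul _ _).le
    _ = (∑ j, ‖X p j‖ ^ 2) * ∑ j, ∑ a, ‖W j a‖ ^ 2 := by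
        rw [← Finset.mul_sum, Finset.sum_comm]
    _ ≤ (∑ j, ‖X p j‖ ^ 2) * ∑ _j : Fin n, (1 : ℝ) := by
        gcongr with j
        exact hW j
    _ = _ := by simp

/-- Replace each vector by its Rademacher sum and cut off at height `√12`. The bounded part is
controlled pointwise by `normF X`, the tail by `c` itself because its second moment is small. -/
theorem TensorSqBound.truncate {m n : ℕ} {X : Matrix (Fin m) (Fin n) ℂ} {c : ℝ}
    (h : TensorSqBound X c) : TensorSqBound X (24 * normF X ^ 2 + c / 2) := by
  intro ι _ W hW
  obtain ⟨Ω, _, _, ε, hε⟩ := exists_rademacher_fintype ι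
  set N : ℝ := (Fintype.card Ω : ℝ) with hN
  have hNpos : 0 < N := by rw [hN]; exact_mod_cast Fintype.card_pos
  let f : Fin n → Ω → ℂ := fun j ω => ∑ a, W j a * ε a ω
  let g : Fin n → Ω → ℂ := fun j ω => if ‖f j ω‖ ^ 2 ≤ 12 then f j ω else 0
  let r : Fin n → Ω → ℂ := fun j ω => if ‖f j ω‖ ^ 2 ≤ 12 then 0 else f j ω
  have hfgr : f = fun j ω => g j ω + r j ω := by
    ext j ω
    by_cases hle : ‖f j ω‖ ^ 2 ≤ 12 <;> simp [g, r, hle]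
  have hf : tensorSq X f = N * tensorSq X W := by
    simp only [tensorSq, Finset.mul_sum]
    refine Finset.sum_congr rfl fun p _ => ?_
    have h1 : ∀ ω, ∑ j, X p j * f j ω = ∑ a, (∑ j, X p j * W j a) * ε a ω := fun ω => by
      simp only [f, Finset.mul_sum, Finset.sum_mul, mul_assoc]
      exact Finset.sum_comm
    simp only [h1]
    rw [(hε _).1, Finset.mul_sum]
  have hg : tensorSq X g ≤ N * (12 * normF X ^ 2) := by
    rw [tensorSq_eq_sum_norm_opF_sq]
    calc ∑ ω, ‖opF X fun j => g j ω‖ ^ 2 ≤ ∑ _ω : Ω, 12 * normF X ^ 2 := by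
          refine Finset.sum_le_sum fun ω _ => ?_
          have hgn : ‖fun j => g j ω‖ ≤ Real.sqrt 12 := by
            refine (pi_norm_le_iff_of_nonneg (Real.sqrt_nonneg _)).2 fun j => ?_
            refine Real.le_sqrt_of_sq_le ?_
            by_cases hle : ‖f j ω‖ ^ 2 ≤ 12
            · simp only [g, if_pos hle]; exact hle
            · simp [g, hle]
          calc ‖opF X fun j => g j ω‖ ^ 2 ≤ (normF X * Real.sqrt 12) ^ 2 := by
                gcongr
                exact (opF X).le_of_opNorm_le_of_le le_rfl hgn
            _ = 12 * normF X ^ 2 := by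
                rw [mul_pow, Real.sq_sqrt (by norm_num)]; ring
      _ = N * (12 * normF X ^ 2) := by simp [hN]
  -- The fourth moment bound 3 and the cut-off 12 give tail mass `3/12 = 1/4`; doubling in
  -- `tensorSq_add_le` leaves `c / 2`.
  have hr : tensorSq X r ≤ c * (N / 4) := by
    refine h.le_mul r (show 0 ≤ N / 4 by positivity) fun j => ?_
    calc ∑ ω, ‖r j ω‖ ^ 2 ≤ ∑ ω, (1 / 12) * ‖f j ω‖ ^ 4 := by
          refine Finset.sum_le_sum fun ω _ => ?_
          by_cases hle : ‖f j ω‖ ^ 2 ≤ 12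
          · rw [show r j ω = 0 from if_pos hle, norm_zero, zero_pow two_ne_zero]; positivity
          · simp only [r, if_neg hle]
            nlinarith [sq_nonneg ‖f j ω‖]
      _ ≤ (1 / 12) * (3 * N * (∑ a, ‖W j a‖ ^ 2) ^ 2) := by
          rw [← Finset.mul_sum]
          gcongr
          exact (hε _).2
      _ ≤ (1 / 12) * (3 * N * 1 ^ 2) := by
          gcongr
          exact hW j
      _ = N / 4 := by ring
  have := tensorSq_add_le X g r
  rw [← hfgr, hf] at this
  have h2 : N * tensorSq X W ≤ N * (24 * normF X ^ 2 + c / 2) := by linarith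
  exact le_of_mul_le_mul_left h2 hNpos

/-- The little Grothendieck inequality, with a non-optimal constant. -/
theorem tensorSqBound_normF {m n : ℕ} (X : Matrix (Fin m) (Fin n) ℂ) :
    TensorSqBound X (48 * normF X ^ 2) := by
  have hne : {c | TensorSqBound X c}.Nonempty := exists_tensorSqBound X
  have hbdd : BddBelow {c | TensorSqBound X c} := ⟨0, fun c hc => TensorSqBound.nonneg hc⟩
  have hmem : TensorSqBound X (sInf {c | TensorSqBound X c}) := fun ι _ W hW =>
    le_csInf hne fun c hc => hc ι W hW
  -- The least bound `c` satisfies `c ≤ 24 ‖X‖_F² + c / 2`, so `c ≤ 48 ‖X‖_F²`.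
  have := csInf_le hbdd hmem.truncate
  exact fun ι _ W hW => (hmem ι W hW).trans (by linarith)

/-! ### The completely bounded norm through `tensorSq` -/

section Amplification

open scoped Matrix.Norms.L2Operator

theorem ampF_mulVec {m n k : ℕ} (X : Matrix (Fin m) (Fin n) ℂ)
    (A : Fin n → Matrix (Fin k) (Fin k) ℂ) (v : Fin k → ℂ) (p : Fin m) (a : Fin k) :
    (ampF k X A).mulVec v (p, a) = ∑ j, X p j * (A j).mulVec v a := by
  change ∑ t, (∑ j, X p j * A j a t) * v t = _
  simp only [Matrix.mulVec, dotProduct, Finset.sum_mul, Finset.mul_sum, mul_assoc]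
  exact Finset.sum_comm

theorem sum_norm_mulVec_sq_le {ι κ : Type} [Fintype ι] [Fintype κ] [DecidableEq κ]
    (A : Matrix ι κ ℂ) (v : κ → ℂ) :
    ∑ i, ‖A.mulVec v i‖ ^ 2 ≤ ‖A‖ ^ 2 * ∑ j, ‖v j‖ ^ 2 := by
  have h := A.l2_opNorm_mulVec (WithLp.toLp 2 v)
  have h2 := pow_le_pow_left₀ (norm_nonneg _) h 2
  rw [mul_pow, EuclideanSpace.norm_sq_eq, EuclideanSpace.norm_sq_eq] at h2
  exact h2

theorem sum_norm_ampF_mulVec_sq {m n k : ℕ} (X : Matrix (Fin m) (Fin n) ℂ)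
    (A : Fin n → Matrix (Fin k) (Fin k) ℂ) (v : Fin k → ℂ) :
    ∑ q, ‖(ampF k X A).mulVec v q‖ ^ 2 = tensorSq X fun j => (A j).mulVec v := by
  rw [Fintype.sum_prod_type]
  simp only [ampF_mulVec, tensorSq]

theorem l2_opNorm_le_of_forall {ι κ : Type} [Fintype ι] [Fintype κ] [DecidableEq κ]
    (A : Matrix ι κ ℂ) {c : ℝ} (hc : 0 ≤ c)
    (h : ∀ v : κ → ℂ, ∑ i, ‖A.mulVec v i‖ ^ 2 ≤ c ^ 2 * ∑ j, ‖v j‖ ^ 2) : ‖A‖ ≤ c := by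
  rw [Matrix.l2_opNorm_def]
  refine ContinuousLinearMap.opNorm_le_bound _ hc fun v => ?_
  refine le_of_sq_le_sq ?_ (by positivity)
  rw [mul_pow, EuclideanSpace.norm_sq_eq, EuclideanSpace.norm_sq_eq]
  exact h v

theorem normCbF_le_of_tensorSqBound {m n : ℕ} {X : Matrix (Fin m) (Fin n) ℂ} {c : ℝ}
    (hc : 0 ≤ c) (h : TensorSqBound X (c ^ 2)) : normCbF X ≤ c := by
  refine ciSup_le fun k => ContinuousLinearMap.opNorm_le_bound _ hc fun A => ?_
  refine l2_opNorm_le_of_forall _ (by positivity) fun v => ?_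
  rw [sum_norm_ampF_mulVec_sq, mul_pow, mul_assoc]
  refine h.le_mul _ (by positivity) fun j => ?_
  refine (sum_norm_mulVec_sq_le _ _).trans ?_
  gcongr
  exact norm_le_pi_norm A j

theorem norm_ampF_le_normCbF {m n : ℕ} (X : Matrix (Fin m) (Fin n) ℂ) (k : ℕ) :
    ‖ampF k X‖ ≤ normCbF X :=
  le_ciSup (bddAbove_norm_ampF X) k

theorem normCbF_nonneg {m n : ℕ} (X : Matrix (Fin m) (Fin n) ℂ) : 0 ≤ normCbF X :=
  (ContinuousLinearMap.opNorm_nonneg _).trans (norm_ampF_le_normCbF X 0)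

/-- Put `W j` in one column of a `k × k` matrix, a contraction; the amplification applied to the
corresponding basis vector recovers the tensor sum. -/
theorem tensorSq_le_normCbF_sq {m n k : ℕ} (X : Matrix (Fin m) (Fin n) ℂ)
    (W : Fin n → Fin k → ℂ) (hW : ∀ j, ∑ a, ‖W j a‖ ^ 2 ≤ 1) :
    tensorSq X W ≤ normCbF X ^ 2 := by
  rcases k.eq_zero_or_pos with rfl | hk
  · simp [tensorSq, sq_nonneg]
  let z : Fin k := ⟨0, hk⟩
  let A : Fin n → Matrix (Fin k) (Fin k) ℂ := fun j => Matrix.vecMulVec (W j) (Pi.single z 1)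
  have hAv : ∀ j v, (A j).mulVec v = fun a => W j a * v z := fun j v => by
    ext a
    simp [A, Matrix.mulVec, dotProduct, Matrix.vecMulVec_apply, Pi.single_apply]
  have hA : ‖A‖ ≤ 1 := by
    refine (pi_norm_le_iff_of_nonneg zero_le_one).2 fun j => ?_
    refine l2_opNorm_le_of_forall _ zero_le_one fun v => ?_
    simp only [hAv, norm_mul, mul_pow, ← Finset.sum_mul, one_pow, one_mul]
    calc (∑ a, ‖W j a‖ ^ 2) * ‖v z‖ ^ 2 ≤ 1 * ‖v z‖ ^ 2 := by
          gcongr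
          exact hW j
      _ ≤ ∑ j, ‖v j‖ ^ 2 := by
          rw [one_mul]
          exact Finset.single_le_sum (f := fun j => ‖v j‖ ^ 2) (fun _ _ => by positivity)
            (Finset.mem_univ z)
  have h1 := sum_norm_mulVec_sq_le (ampF k X A) (Pi.single z 1)
  rw [sum_norm_ampF_mulVec_sq] at h1
  have h2 : (fun j => (A j).mulVec (Pi.single z 1)) = W := by
    ext j a
    simp [hAv]
  have h3 : ∑ j, ‖(Pi.single z 1 : Fin k → ℂ) j‖ ^ 2 = 1 := by
    rw [Finset.sum_eq_single z (by intro b _ hb; simp [hb]) (by simp)]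
    simp
  rw [h2, h3, mul_one] at h1
  refine h1.trans ?_
  gcongr
  calc ‖ampF k X A‖ ≤ ‖ampF k X‖ * 1 := (ampF k X).le_of_opNorm_le_of_le le_rfl hA
    _ ≤ normCbF X := by rw [mul_one]; exact norm_ampF_le_normCbF X k

end Amplification

/-! ### The constant `kG` and the norm at unitaries -/

theorem normF_nonneg {m n : ℕ} (X : Matrix (Fin m) (Fin n) ℂ) : 0 ≤ normF X := norm_nonneg _

theorem forty_eight_mem_kG_set :
    (48 : ℝ) ∈ {κ : ℝ | 0 < κ ∧
      ∀ (m n : ℕ) (X : Matrix (Fin m) (Fin n) ℂ), normCbF X ≤ Real.sqrt κ * normF X} := by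
  refine ⟨by norm_num, fun m n X => normCbF_le_of_tensorSqBound
    (mul_nonneg (Real.sqrt_nonneg _) (normF_nonneg X)) ?_⟩
  rw [mul_pow, Real.sq_sqrt (by norm_num)]
  exact tensorSqBound_normF X

theorem kG_nonneg : 0 ≤ kG := Real.sInf_nonneg fun _ h => h.1.le

theorem normCbF_sq_le {m n : ℕ} (X : Matrix (Fin m) (Fin n) ℂ) :
    normCbF X ^ 2 ≤ kG * normF X ^ 2 := by
  have key : ∀ κ ∈ {κ : ℝ | 0 < κ ∧
      ∀ (m n : ℕ) (X : Matrix (Fin m) (Fin n) ℂ), normCbF X ≤ Real.sqrt κ * normF X},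
      normCbF X ^ 2 ≤ κ * normF X ^ 2 := fun κ hκ => by
    have := pow_le_pow_left₀ (normCbF_nonneg X) (hκ.2 m n X) 2
    rwa [mul_pow, Real.sq_sqrt hκ.1.le] at this
  -- Division by `normF X ^ 2` is impossible when it vanishes; any admissible constant then gives
  -- `normCbF X = 0`.
  rcases (sq_nonneg (normF X)).eq_or_lt with h0 | hpos
  · have := key _ forty_eight_mem_kG_set
    rw [← h0] at this ⊢
    linarith
  · rw [← div_le_iff₀ hpos]
    exact le_csInf ⟨48, forty_eight_mem_kG_set⟩ fun κ hκ => (div_le_iff₀ hpos).2 (key κ hκ)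

theorem mem_unitary_pi_iff {n : ℕ} {u : Fin n → ℂ} :
    u ∈ unitary (Fin n → ℂ) ↔ ∀ j, ‖u j‖ = 1 := by
  have h : ∀ z : ℂ, star z * z = 1 ↔ ‖z‖ = 1 := fun z => by
    rw [Complex.star_def, Complex.conj_mul', ← Complex.ofReal_pow, Complex.ofReal_eq_one,
      pow_eq_one_iff_of_nonneg (norm_nonneg z) two_ne_zero]
  rw [Unitary.mem_iff, mul_comm u, and_self]
  simp only [funext_iff, Pi.mul_apply, Pi.star_apply, Pi.one_apply, h]

/-- The operator norm on the unit ball of `ℓ^∞` is attained at unitaries. -/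
theorem mul_normF_le_of_unitary {m n : ℕ} (X : Matrix (Fin m) (Fin n) ℂ) {c t : ℝ} (hc : 0 ≤ c)
    (ht : 0 ≤ t) (h : ∀ u ∈ unitary (Fin n → ℂ), c * ‖opF X u‖ ≤ t) : c * normF X ≤ t := by
  have hconv : Convex ℝ {a : Fin n → ℂ | ‖(c : ℂ) • opF X a‖ ≤ t} := by
    have := ((convexOn_univ_norm (E := EuclideanSpace ℂ (Fin m))).comp_linearMap
      (((c : ℂ) • opF X).toLinearMap.restrictScalars ℝ)).convex_le t
    simpa using this
  have hnorm : ∀ a, ‖(c : ℂ) • opF X a‖ = c * ‖opF X a‖ := fun a => by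
    rw [norm_smul, Complex.norm_real, Real.norm_of_nonneg hc]
  have hball : ∀ a : Fin n → ℂ, ‖a‖ ≤ 1 → c * ‖opF X a‖ ≤ t := fun a ha => by
    rw [← hnorm]
    -- The closed polydisc is the convex hull of the torus, coordinate by coordinate.
    have hmem : a ∈ convexHull ℝ (Set.univ.pi fun _ : Fin n => Metric.sphere (0 : ℂ) 1) := by
      rw [convexHull_pi]
      intro j _
      rw [convexHull_sphere_eq_closedBall _ zero_le_one, mem_closedBall_zero_iff]
      exact (norm_le_pi_norm a j).trans ha
    refine convexHull_min (fun u hu => ?_) hconv hmem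
    rw [Set.mem_ofPred_eq, hnorm]
    exact h u (mem_unitary_pi_iff.2 fun j => mem_sphere_zero_iff_norm.1 (hu j trivial))
  have : ‖(c : ℂ) • opF X‖ ≤ t := by
    refine ContinuousLinearMap.opNorm_le_of_unit_norm ht fun a ha => ?_
    change ‖(c : ℂ) • opF X a‖ ≤ t
    rw [hnorm]
    exact hball a ha.le
  rwa [norm_smul, Complex.norm_real, Real.norm_of_nonneg hc] at this

/-! ### Positive functionals on matrices -/

section Factorization

open scoped MatrixOrder

theorem exists_eq_conjTranspose_mul_self {n : ℕ} {A : Matrix (Fin n) (Fin n) ℂ}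
    (hA : A.PosSemidef) : ∃ G : Matrix (Fin n) (Fin n) ℂ, A = G.conjTranspose * G := by
  obtain ⟨G, hG⟩ := CStarAlgebra.nonneg_iff_eq_star_mul_self.1 hA.nonneg
  exact ⟨G, hG⟩

end Factorization

theorem sum_eq_tensorSq {n : ℕ} {ι : Type} [Fintype ι] (X : Matrix (Fin n) (Fin n) ℂ)
    (W : Matrix ι (Fin n) ℂ) :
    ∑ i, ∑ j, (X.conjTranspose * X) i j * (W.conjTranspose * W) i j
      = (tensorSq X (fun j a => W a j) : ℂ) := by
  have h : ∀ p a, ((‖∑ j, X p j * W a j‖ ^ 2 : ℝ) : ℂ)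
      = ∑ i, ∑ j, star (X p i) * X p j * (star (W a i) * W a j) := fun p a => by
    rw [Complex.ofReal_pow, ← Complex.conj_mul', map_sum, Finset.sum_mul_sum]
    refine Finset.sum_congr rfl fun i _ => Finset.sum_congr rfl fun j _ => ?_
    rw [map_mul]
    simp only [Complex.star_def]
    ring
  simp only [tensorSq, Complex.ofReal_sum, h, Matrix.mul_apply, Matrix.conjTranspose_apply,
    Finset.sum_mul_sum]
  symm
  rw [Finset.sum_congr rfl fun p _ => Finset.sum_comm, Finset.sum_comm]
  refine Finset.sum_congr rfl fun i _ => ?_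
  rw [Finset.sum_congr rfl fun p _ => Finset.sum_comm, Finset.sum_comm]

/-- A real-linear functional on matrices is represented on Hermitian matrices by a Hermitian
matrix. -/
theorem exists_isHermitian_repr {n : ℕ} (f : Matrix (Fin n) (Fin n) ℂ →ₗ[ℝ] ℝ) :
    ∃ H : Matrix (Fin n) (Fin n) ℂ, H.IsHermitian ∧
      ∀ Z : Matrix (Fin n) (Fin n) ℂ, Z.IsHermitian → f Z = (∑ i, ∑ j, H i j * Z i j).re := by
  -- The sign makes `Re (B i j * z) = Re z * f (E i j) + Im z * f (I • E i j)`, with `E i j` the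
  -- matrix units.
  let B : Matrix (Fin n) (Fin n) ℂ := Matrix.of fun i j =>
    ⟨f (Matrix.single i j 1), -f (Matrix.single i j Complex.I)⟩
  have hB : ∀ Z, f Z = (∑ i, ∑ j, B i j * Z i j).re := fun Z => by
    conv_lhs => rw [Matrix.matrix_eq_sum_single Z]
    simp only [map_sum, Complex.re_sum]
    refine Finset.sum_congr rfl fun i _ => Finset.sum_congr rfl fun j _ => ?_
    have : Matrix.single i j (Z i j) = (Z i j).re • Matrix.single i j (1 : ℂ)
        + (Z i j).im • Matrix.single i j Complex.I := by
      rw [Matrix.smul_single, Matrix.smul_single, ← Matrix.single_add]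
      congr 1
      apply Complex.ext <;> simp
    rw [this, map_add, map_smul, map_smul]
    simp [B, Complex.mul_re]
    ring
  refine ⟨(2⁻¹ : ℝ) • (B + B.conjTranspose), ?_, fun Z hZ => ?_⟩
  · rw [Matrix.IsHermitian, Matrix.conjTranspose_smul, Matrix.conjTranspose_add,
      Matrix.conjTranspose_conjTranspose, add_comm]
    simp
  · have h2 : (∑ i, ∑ j, B.conjTranspose i j * Z i j).re = f Z := by
      rw [hB, Finset.sum_comm]
      simp only [Complex.re_sum]
      refine Finset.sum_congr rfl fun i _ => Finset.sum_congr rfl fun j _ => ?_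
      rw [← hZ.apply i j, Matrix.conjTranspose_apply]
      simp [Complex.mul_re]
    have h1 := hB Z
    simp only [Matrix.smul_apply, Matrix.add_apply, smul_mul_assoc, ← Finset.smul_sum, add_mul,
      Finset.sum_add_distrib, Complex.smul_re, Complex.add_re, h2, ← h1]
    simp only [smul_eq_mul]
    ring

/-- A real-linear functional that is nonnegative on positive semidefinite matrices is a squared
Hilbert-space norm on matrices of the form `Wᴴ W`. -/
theorem exists_eq_tensorSq {n : ℕ} (f : Matrix (Fin n) (Fin n) ℂ →ₗ[ℝ] ℝ)
    (hf : ∀ P : Matrix (Fin n) (Fin n) ℂ, P.PosSemidef → 0 ≤ f P) :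
    ∃ X : Matrix (Fin n) (Fin n) ℂ, ∀ (ι : Type) [Fintype ι] (W : Matrix ι (Fin n) ℂ),
      f (W.conjTranspose * W) = tensorSq X (fun j a => W a j) := by
  obtain ⟨H, hH, hfH⟩ := exists_isHermitian_repr f
  have hpos : H.PosSemidef := by
    -- The quadratic form of `H` at `v` is `f` at the positive rank one matrix `v̄ vᵀ`.
    refine Matrix.PosSemidef.of_dotProduct_mulVec_nonneg hH fun v => ?_
    have hv : star v ⬝ᵥ H.mulVec v = ∑ i, ∑ j, H i j * Matrix.vecMulVec (star v) v i j := by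
      simp only [dotProduct, Matrix.mulVec, Matrix.vecMulVec_apply, Finset.mul_sum]
      refine Finset.sum_congr rfl fun i _ => Finset.sum_congr rfl fun j _ => ?_
      ring
    have hZ : (Matrix.vecMulVec (star v) v).PosSemidef := by
      simpa using Matrix.posSemidef_vecMulVec_self_star (star v)
    rw [Complex.nonneg_iff]
    refine ⟨?_, (hH.im_star_dotProduct_mulVec_self v).symm⟩
    rw [hv, ← hfH _ hZ.isHermitian]
    exact hf _ hZ
  obtain ⟨X, rfl⟩ := exists_eq_conjTranspose_mul_self hpos
  refine ⟨X, fun ι _ W => ?_⟩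
  rw [hfH _ (Matrix.isHermitian_conjTranspose_mul_self W), sum_eq_tensorSq, Complex.ofReal_re]

/-! ### Separation -/

theorem isClosed_posSemidef (n : ℕ) :
    IsClosed {P : Matrix (Fin n) (Fin n) ℂ | P.PosSemidef} := by
  simp only [Matrix.posSemidef_iff_dotProduct_mulVec, Set.ofPred_and, Set.ofPred_forall]
  refine IsClosed.inter (isClosed_eq (by fun_prop) continuous_id) (isClosed_iInter fun x => ?_)
  exact isClosed_le continuous_const (by fun_prop)

theorem isCompact_setR (n : ℕ) : IsCompact (setR n) := by
  have hK : IsCompact (Set.univ.pi fun _ : Fin n => Set.univ.pi fun _ : Fin n =>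
      Metric.closedBall (0 : ℂ) 1) :=
    isCompact_univ_pi fun _ => isCompact_univ_pi fun _ => isCompact_closedBall _ _
  refine IsCompact.of_isClosed_subset (X := Matrix (Fin n) (Fin n) ℂ) hK
    isClosed_closure (closure_minimal (convexHull_min ?_ ?_) hK.isClosed)
  · rintro _ ⟨u, hu, rfl⟩ i _ j _
    rw [mem_closedBall_zero_iff, Matrix.vecMulVec_apply, norm_mul, Pi.star_apply, norm_star,
      mem_unitary_pi_iff.1 hu, mem_unitary_pi_iff.1 hu, mul_one]
  · exact convex_pi fun _ _ => convex_pi fun _ _ => convex_closedBall _ _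

theorem convex_setR (n : ℕ) : Convex ℝ (setR n) := (convex_convexHull ℝ _).closure

theorem vecMulVec_mem_setR {n : ℕ} {u : Fin n → ℂ} (hu : u ∈ unitary (Fin n → ℂ)) :
    Matrix.vecMulVec (star u) u ∈ setR n :=
  subset_closure (subset_convexHull ℝ _ ⟨u, hu, rfl⟩)

theorem convex_posSemidef (n : ℕ) :
    Convex ℝ {P : Matrix (Fin n) (Fin n) ℂ | P.PosSemidef} := fun _ hP _ hQ _ _ ha hb _ =>
  (hP.smul ha).add (hQ.smul hb)

open scoped Pointwise in
theorem exists_setR_sub_posSemidef {n : ℕ} {Q : Matrix (Fin n) (Fin n) ℂ} (hQ : Q ∈ setQ n) :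
    ∃ R ∈ setR n, ∃ P : Matrix (Fin n) (Fin n) ℂ, P.PosSemidef ∧ Q = kG • R - P := by
  by_contra hcon
  let C : Set (Matrix (Fin n) (Fin n) ℂ) :=
    (-{P | P.PosSemidef}) + kG • setR n
  have hC : ∀ R ∈ setR n, ∀ P : Matrix (Fin n) (Fin n) ℂ, P.PosSemidef → kG • R - P ∈ C :=
    fun R hR P hP => ⟨-P, by simpa using hP, kG • R, ⟨R, hR, rfl⟩, by
      change -P + kG • R = _; abel⟩
  have hQC : Q ∉ C := by
    rintro ⟨P, hP, _, ⟨R, hR, rfl⟩, rfl⟩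
    exact hcon ⟨R, hR, -P, hP, by change P + kG • R = _; abel⟩
  have hconv : Convex ℝ C := (convex_posSemidef n).neg.add ((convex_setR n).smul kG)
  -- Compactness of `setR n` matters: a sum of two merely closed sets need not be closed.
  have hclosed : IsClosed C :=
    (isClosed_posSemidef n).neg.add_right_of_isCompact ((isCompact_setR n).smul kG)
  have : LocallyConvexSpace ℝ (Matrix (Fin n) (Fin n) ℂ) :=
    inferInstanceAs (LocallyConvexSpace ℝ (Fin n → Fin n → ℂ))
  obtain ⟨f, s, hs, hsQ⟩ := geometric_hahn_banach_closed_point hconv hclosed hQC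
  have hone : (1 : Fin n → ℂ) ∈ unitary (Fin n → ℂ) := one_mem _
  have hfpos : ∀ P : Matrix (Fin n) (Fin n) ℂ, P.PosSemidef → 0 ≤ f P := fun P hP => by
    by_contra! hneg
    set r := f (kG • Matrix.vecMulVec (star (1 : Fin n → ℂ)) 1) with hr
    -- Subtracting this multiple of `P` raises `f` from `r` to `r + |s - r| ≥ s`.
    have ht : 0 ≤ |s - r| / (-f P) := div_nonneg (abs_nonneg _) (by linarith)
    have := hs _ (hC _ (vecMulVec_mem_setR hone) ((|s - r| / (-f P)) • P) (hP.smul ht))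
    rw [map_sub, map_smul f (|s - r| / (-f P)), ← hr, smul_eq_mul] at this
    have h2 : |s - r| / (-f P) * f P = -|s - r| := by
      rw [div_neg, neg_mul, div_mul_cancel₀ _ hneg.ne]
    rw [h2] at this
    linarith [le_abs_self (s - r)]
  obtain ⟨X, hX⟩ := exists_eq_tensorSq f.toLinearMap hfpos
  have hu : ∀ u ∈ unitary (Fin n → ℂ), kG * ‖opF X u‖ ^ 2 ≤ s := fun u hu => by
    have h1 := hs _ (hC _ (vecMulVec_mem_setR hu) 0 Matrix.PosSemidef.zero)
    have h2 := hX Unit (Matrix.replicateRow Unit u)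
    have h3 : (Matrix.replicateRow Unit u).conjTranspose * Matrix.replicateRow Unit u
        = Matrix.vecMulVec (star u) u := by
      ext i j
      simp [Matrix.mul_apply, Matrix.vecMulVec_apply]
    rw [h3, tensorSq_eq_sum_norm_opF_sq] at h2
    simp only [Finset.univ_unique, Finset.sum_const, Finset.card_singleton, one_smul,
      Matrix.replicateRow_apply] at h2
    rw [sub_zero, map_smul, smul_eq_mul] at h1
    rw [← h2]
    exact h1.le
  have hs0 : 0 ≤ s := (mul_nonneg kG_nonneg (sq_nonneg _)).trans (hu 1 hone)
  have hnorm : kG * normF X ^ 2 ≤ s := by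
    have := mul_normF_le_of_unitary X (Real.sqrt_nonneg kG) (Real.sqrt_nonneg s) fun u hu' => by
      refine Real.le_sqrt_of_sq_le ?_
      rw [mul_pow, Real.sq_sqrt kG_nonneg]
      exact hu u hu'
    have h2 := pow_le_pow_left₀ (mul_nonneg (Real.sqrt_nonneg _) (normF_nonneg X)) this 2
    rwa [mul_pow, Real.sq_sqrt kG_nonneg, Real.sq_sqrt hs0] at h2
  obtain ⟨G, rfl⟩ := exists_eq_conjTranspose_mul_self hQ.1
  have hfQ : f (G.conjTranspose * G) = tensorSq X fun j a => G a j := hX (Fin n) G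
  -- The diagonal of `Q = Gᴴ G` lists the squared column norms of `G`.
  have hG : ∀ j, ∑ a, ‖G a j‖ ^ 2 ≤ 1 := fun j => by
    have h1 := hQ.2 j
    simp only [Matrix.mul_apply, Matrix.conjTranspose_apply, Complex.star_def,
      Complex.conj_mul'] at h1
    exact le_of_eq (by exact_mod_cast h1)
  have := tensorSq_le_normCbF_sq X (fun j a => G a j) hG
  linarith [normCbF_sq_le X]

end LittleGrothendieck

theorem mainTheorem3 (n : ℕ) (Q : Matrix (Fin n) (Fin n) ℂ)
    (hQ : Q ∈ LittleGrothendieck.setQ n) :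
    ∃ R ∈ LittleGrothendieck.setR n, ∃ P : Matrix (Fin n) (Fin n) ℂ,
      P.PosSemidef ∧ Q = (LittleGrothendieck.kG : ℂ) • R - P := by
  obtain ⟨R, hR, P, hP, h⟩ := LittleGrothendieck.exists_setR_sub_posSemidef hQ
  exact ⟨R, hR, P, hP, by rw [Complex.coe_smul]; exact h⟩
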